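/- Let $(X,d)$ be a proper non-compact metric space with a Borel measure $\mu$, let $B_x(r)$ be the closed ball of centre $x$ and radius $r$, and assume that $X=(X,d,\mu)$ is of class A, i.e.: (i) $\mu(B_x(r))>0$ for all $x\in X$, $r>0$, and $\sup_x\mu(B_x(r))<\infty$ for all $r>0$; (ii) $\inf_x\mu(B_x(1/2))>0$; (iii) (Property A) for all $\varepsilon,r>0$ there are a Borel map $\phi:X\to L^2(X,\mu)$ and a number $s$ such that $\|\phi(x)\|=1$ and $\operatorname{supp}\phi(x)\subset B_x(s)$ for all $x$, and $\|\phi(x)-\phi(y)\|<\varepsilon$ whenever $d(x,y)<r$. Let $\mathscr E(X)$ be the closure, in the operator norm of bounded operators on $L^2(X,\mu)$, of the set of integral operators $(Op(k)f)(x)=\int_X k(x,y)f(y)\,d\mu(y)$, where $k:X\times X\to\mathbb C$ is bounded, uniformly continuous and controlled (there is $r$ such that $k(x,y)=0$ if $d(x,y)>r$). For a measurable set $A\subset X$ let $1_A$ also denote the operator of multiplication by its characteristic function. For $F\subset X$ and $r>0$ let $F^{(r)}=\{x\in X:\inf_{y\notin F}d(x,y)>r\}$. A filter $\xi$ on $X$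 is coarse if $F\in\xi$ implies $F^{(r)}\in\xi$ for all $r>0$. For a filter $\xi$ let $\mathrm{co}(\xi)$ be the largest coarse filter contained in $\xi$, and let $$\mathscr J_\xi=\{T\in\mathscr E(X):\inf_{F\in\xi}\|1_FT\|=0\},\qquad \mathscr G_\xi=\{T\in\mathscr E(X):\lim_{x\to\xi}\|1_{B_x(r)}T\|=0\ \text{ for all } r>0\},$$ the infimum being over the measurable sets $F\in\xi$. The Fréchet filter consists of the sets with relatively compact complement, and $\delta(X)$ is the set of ultrafilters on $X$ finer than it. For $\varkappa\in\delta(X)$ put $\mathscr E_{(\varkappa)}(X)=\mathscr J_{\mathrm{co}(\varkappa)}$. **Theorem.** Let $\xi$ be a (proper) filter on $X$ finer than the Fréchet filter and let $T\in\mathscr E(X)$. Then $$T\in\mathscr J_{\mathrm{co}(\xi)}\iff \lim_{x\to\xi}\|T1_{B_x(r)}\|=0\ \text{ for all } r>0\iff \lim_{x\to\xi}\|1_{B_x(r)}T\|=0\ \text{ for all } r>0 .$$ In particular, $\mathscr E_{(\varkappa)}(X)=\mathscr G_\varkappa$ for every $\varkappa\in\delta(X)$. -/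

import Mathlib

open MeasureTheory Filter Topology Set
open scoped ENNReal

namespace CoarseElliptic

noncomputable section

/-! ### Class A spaces -/

/-- The Hilbert space `L²(X, μ)` of complex functions. -/
abbrev L2 {X : Type*} [MeasurableSpace X] (μ : Measure X) : Type _ := Lp ℂ 2 μ

/-- The algebra of all bounded operators on `L²(X, μ)`. -/
abbrev Bdd {X : Type*} [MeasurableSpace X] (μ : Measure X) : Type _ := L2 μ →L[ℂ] L2 μ

/-- Property A: for all `ε, r > 0` there is a Borel map `φ : X → L²(X)` with `‖φ x‖ = 1`, with
`φ x` supported in the closed ball `B_x(s)` for some `s` independent of `x`, and with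
`‖φ x - φ y‖ < ε` whenever `d(x, y) < r`. -/
def HasPropertyA {X : Type*} [MetricSpace X] [MeasurableSpace X] (μ : Measure X) : Prop :=
  ∀ ε : ℝ, 0 < ε → ∀ r : ℝ, 0 < r → ∃ φ : X → L2 μ,
    Measurable[_, borel (L2 μ)] φ ∧
    (∀ x, ‖φ x‖ = 1) ∧
    (∃ s : ℝ, ∀ x, ∀ᵐ y ∂μ, y ∉ Metric.closedBall x s → φ x y = 0) ∧
    (∀ x y, dist x y < r → ‖φ x - φ y‖ < ε)

/-- Class A spaces: proper non-compact metric spaces with a Borel measure for which the volumes of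
the balls of a given radius are positive and uniformly bounded, the volumes of the balls of radius
`1/2` are bounded below, and Property A holds. -/
structure IsClassA {X : Type*} [MetricSpace X] [MeasurableSpace X] [BorelSpace X]
    (μ : Measure X) : Prop where
  proper : ProperSpace X
  noncompact : NoncompactSpace X
  ball_pos : ∀ r : ℝ, 0 < r → ∀ x : X, 0 < μ (Metric.closedBall x r)
  ball_bdd : ∀ r : ℝ, 0 < r → ⨆ x : X, μ (Metric.closedBall x r) < ∞
  half_ball : 0 < ⨅ x : X, μ (Metric.closedBall x (1 / 2))
  propertyA : HasPropertyA μ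

/-! ### The elliptic algebra -/

/-- `k` is a bounded uniformly continuous controlled kernel on `X`. -/
structure IsTrlKernel {X : Type*} [MetricSpace X] (k : X × X → ℂ) : Prop where
  bounded : ∃ M : ℝ, ∀ p, ‖k p‖ ≤ M
  uniformContinuous : UniformContinuous k
  controlled : ∃ r : ℝ, ∀ x y, r < dist x y → k (x, y) = 0

/-- `T = Op(k)`: `(T f)(x) = ∫ k(x, y) f(y) dμ(y)` for every `f ∈ L²`. When `k` is a bounded
continuous controlled kernel and balls of a given radius have uniformly bounded volumes, the
integrals converge absolutely for every `x`, and there is exactly one such `T`. -/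
def IsOp {X : Type*} [MeasurableSpace X] (μ : Measure X) (k : X × X → ℂ) (T : Bdd μ) : Prop :=
  ∀ f : L2 μ, (T f : X → ℂ) =ᵐ[μ] fun x => ∫ y, k (x, y) * f y ∂μ

/-- The elliptic algebra: the closure, in operator norm, of the set of the operators `Op(k)` with
`k` a bounded uniformly continuous controlled kernel. -/
def ellipticAlgebra {X : Type*} [MetricSpace X] [MeasurableSpace X] (μ : Measure X) :
    Set (Bdd μ) :=
  closure {T : Bdd μ | ∃ k : X × X → ℂ, IsTrlKernel k ∧ IsOp μ k T}

theorem memLp_indicator {X : Type*} [MeasurableSpace X] {μ : Measure X} {A : Set X}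
    (hA : MeasurableSet A) (f : L2 μ) : MemLp (A.indicator (f : X → ℂ)) 2 μ :=
  MemLp.indicator hA (Lp.memLp f)

/-- The product `1_A f ∈ L²` for a measurable set `A` and `f ∈ L²`. -/
def indFun {X : Type*} [MeasurableSpace X] {μ : Measure X} {A : Set X} (hA : MeasurableSet A)
    (f : L2 μ) : L2 μ :=
  MemLp.toLp (A.indicator (f : X → ℂ)) (memLp_indicator hA f)

theorem indFun_coe {X : Type*} [MeasurableSpace X] {μ : Measure X} {A : Set X}
    (hA : MeasurableSet A) (f : L2 μ) :
    (indFun hA f : X → ℂ) =ᵐ[μ] A.indicator (f : X → ℂ) :=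
  MemLp.coeFn_toLp (memLp_indicator hA f)

theorem indFun_add {X : Type*} [MeasurableSpace X] {μ : Measure X} {A : Set X}
    (hA : MeasurableSet A) (f g : L2 μ) : indFun hA (f + g) = indFun hA f + indFun hA g := by
  apply Lp.ext
  filter_upwards [indFun_coe hA (f + g), indFun_coe hA f, indFun_coe hA g, Lp.coeFn_add f g,
    Lp.coeFn_add (indFun hA f) (indFun hA g)] with x h1 h2 h3 h4 h5
  rw [h1, h5, Pi.add_apply, h2, h3]
  by_cases hx : x ∈ A
  · rw [indicator_of_mem hx, indicator_of_mem hx, indicator_of_mem hx, h4, Pi.add_apply]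
  · rw [indicator_of_notMem hx, indicator_of_notMem hx, indicator_of_notMem hx, add_zero]

theorem indFun_smul {X : Type*} [MeasurableSpace X] {μ : Measure X} {A : Set X}
    (hA : MeasurableSet A) (c : ℂ) (f : L2 μ) : indFun hA (c • f) = c • indFun hA f := by
  apply Lp.ext
  filter_upwards [indFun_coe hA (c • f), indFun_coe hA f, Lp.coeFn_smul c f,
    Lp.coeFn_smul c (indFun hA f)] with x h1 h2 h3 h4
  rw [h1, h4, Pi.smul_apply, h2]
  by_cases hx : x ∈ A
  · rw [indicator_of_mem hx, indicator_of_mem hx, h3, Pi.smul_apply]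
  · rw [indicator_of_notMem hx, indicator_of_notMem hx, smul_zero]

theorem indFun_norm_le {X : Type*} [MeasurableSpace X] {μ : Measure X} {A : Set X}
    (hA : MeasurableSet A) (f : L2 μ) : ‖indFun hA f‖ ≤ 1 * ‖f‖ := by
  rw [one_mul]
  apply Lp.norm_le_norm_of_ae_le
  filter_upwards [indFun_coe hA f] with x hx
  rw [hx]
  exact norm_indicator_le_norm_self _ _

/-- The operator, denoted `1_A`, of multiplication by the characteristic function of a measurable
set `A`. -/
def ind {X : Type*} [MeasurableSpace X] (μ : Measure X) {A : Set X} (hA : MeasurableSet A) :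
    Bdd μ :=
  LinearMap.mkContinuous
    { toFun := indFun hA
      map_add' := indFun_add hA
      map_smul' := indFun_smul hA }
    1 (indFun_norm_le hA)

/-- The operator `1_{B_x(r)}` of multiplication by the characteristic function of the closed ball
of center `x` and radius `r`. -/
def indBall {X : Type*} [MetricSpace X] [MeasurableSpace X] [BorelSpace X] (μ : Measure X)
    (x : X) (r : ℝ) : Bdd μ :=
  ind μ (Metric.isClosed_closedBall (x := x) (ε := r)).measurableSet

/-! ### Coarse filters -/

/-- `F^{(r)}`: the points at distance larger than `r` from the complement of `F`. -/
def deepInterior {X : Type*} [MetricSpace X] (F : Set X) (r : ℝ) : Set X :=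
  {x | ∃ r' : ℝ, r < r' ∧ Metric.closedBall x r' ⊆ F}

/-- A filter `ξ` is coarse if `F ∈ ξ` implies `F^{(r)} ∈ ξ` for all `r > 0`. -/
def IsCoarse {X : Type*} [MetricSpace X] (ξ : Filter X) : Prop :=
  ∀ F ∈ ξ, ∀ r : ℝ, 0 < r → deepInterior F r ∈ ξ

/-- The coarse envelope `co(ξ)`: the supremum, for the inclusion of filters as families of sets, of
the coarse filters included in `ξ`. (Mathlib orders filters by reverse inclusion, so it is written
as an infimum.) -/
def coarseEnvelope {X : Type*} [MetricSpace X] (ξ : Filter X) : Filter X :=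
  sInf {η | IsCoarse η ∧ ξ ≤ η}

/-- The coarse envelope is itself coarse and included in `ξ`: it is the largest coarse filter
included in `ξ`. Moreover it consists of the sets `F` such that `F^{(r)} ∈ ξ` for all `r > 0`. -/
theorem coarseEnvelope_spec {X : Type*} [MetricSpace X] (ξ : Filter X) :
    IsLeast {η | IsCoarse η ∧ ξ ≤ η} (coarseEnvelope ξ) ∧
      ∀ F : Set X, F ∈ coarseEnvelope ξ ↔ ∀ r : ℝ, 0 < r → deepInterior F r ∈ ξ := by
  let ζ : Filter X :=
    { sets := {F | ∀ r : ℝ, 0 < r → deepInterior F r ∈ ξ}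
      univ_sets := fun r _ => mem_of_superset univ_mem fun x _ =>
        ⟨r + 1, by linarith, subset_univ _⟩
      sets_of_superset := fun {F G} hF hFG r hr => mem_of_superset (hF r hr) fun x hx => by
        obtain ⟨r', h, h'⟩ := hx
        exact ⟨r', h, h'.trans hFG⟩
      inter_sets := fun {F G} hF hG r hr =>
        mem_of_superset (inter_mem (hF r hr) (hG r hr)) fun x hx => by
          obtain ⟨⟨a, h, h'⟩, ⟨b, k, k'⟩⟩ := hx
          exact ⟨min a b, lt_min h k, subset_inter
            ((Metric.closedBall_subset_closedBall (min_le_left a b)).trans h')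
            ((Metric.closedBall_subset_closedBall (min_le_right a b)).trans k')⟩ }
  have hmem : ∀ F, F ∈ ζ ↔ ∀ r : ℝ, 0 < r → deepInterior F r ∈ ξ := fun F => Iff.rfl
  have hcoarse : IsCoarse ζ := by
    intro F hF r hr s hs
    refine mem_of_superset (hF (r + s) (by linarith)) fun x hx => ?_
    obtain ⟨t, ht, hsub⟩ := hx
    refine ⟨s + (t - r - s) / 2, by linarith, fun y hy => ⟨r + (t - r - s) / 2, by linarith,
      fun z hz => hsub ?_⟩⟩
    rw [Metric.mem_closedBall] at hy hz ⊢
    linarith [dist_triangle z y x]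
  have hle : ξ ≤ ζ := by
    intro F hF
    refine mem_of_superset (hF 1 one_pos) fun x hx => ?_
    obtain ⟨t, ht, hsub⟩ := hx
    exact hsub (Metric.mem_closedBall_self (by linarith))
  have hleast : IsLeast {η | IsCoarse η ∧ ξ ≤ η} ζ :=
    ⟨⟨hcoarse, hle⟩, fun η hη F hF r hr => hη.2 (hη.1 F hF r hr)⟩
  have heq : coarseEnvelope ξ = ζ := hleast.isGLB.sInf_eq
  rw [heq]
  exact ⟨hleast, hmem⟩

/-! ### Ideals of the elliptic algebra -/

/-- `𝒥_ξ = {T ∈ ℰ | inf_{F ∈ ξ} ‖1_F T‖ = 0}`, the infimum being over the measurable `F ∈ ξ`. -/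
def idealJ {X : Type*} [MetricSpace X] [MeasurableSpace X] (μ : Measure X)
    (ξ : Filter X) : Set (Bdd μ) :=
  {T | T ∈ ellipticAlgebra μ ∧
    ⨅ F : {F : Set X // F ∈ ξ ∧ MeasurableSet F}, ‖ind μ F.2.2 ∘L T‖ = 0}

/-- `𝒢_ξ = {T ∈ ℰ | lim_{x → ξ} ‖1_{B_x(r)} T‖ = 0 for all r > 0}`. -/
def idealG {X : Type*} [MetricSpace X] [MeasurableSpace X] [BorelSpace X] (μ : Measure X)
    (ξ : Filter X) : Set (Bdd μ) :=
  {T | T ∈ ellipticAlgebra μ ∧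
    ∀ r : ℝ, 0 < r → Tendsto (fun x => ‖indBall μ x r ∘L T‖) ξ (𝓝 0)}

/-- `ℰ_(ϰ) = 𝒥_{co(ϰ)}`. -/
def idealE {X : Type*} [MetricSpace X] [MeasurableSpace X] (μ : Measure X)
    (ϰ : Ultrafilter X) : Set (Bdd μ) :=
  idealJ μ (coarseEnvelope (ϰ : Filter X))

/-- `δ(X)`: the ultrafilters finer than the Fréchet filter, that is, the filter of the sets with
relatively compact complement. -/
def delta (X : Type*) [TopologicalSpace X] : Set (Ultrafilter X) :=
  {ϰ | (ϰ : Filter X) ≤ cocompact X}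

end

end CoarseElliptic

/-! Approximate `T` in norm by an integral operator `S` of propagation `R`. Since `S` moves supports
by at most `R`, smallness of `T` on balls passes from one side to the other when radii grow by `R`
(`tendsto_comp_indBall_iff`). If `‖1_F T‖` is small with `F` in the coarse envelope, then `B_x(r) ⊆
F` for `x` along `ξ`, so membership in the ideal gives decay on balls
(`tendsto_indBall_comp_of_mem_idealJ`).

The converse passes from balls to a whole set `F`, the interior of the set of centres around which
`T` is small; decay at every radius puts `F` in the coarse envelope. Property A yields functions
with `∑ ψ_n² = 1`, supports of bounded size and small `ℓ²` variation at scale `R`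
(`HasPropertyA.exists_partition`). In `ψ_n S f = S (ψ_n f) + [ψ_n, S] f` the commutators are small
in square sum (`tsum_lintegral_commutator_le`), and each `1_F S (ψ_n f)` either vanishes or is
controlled by one ball centred in `F`. Because `∑ ‖ψ_n f‖² = ‖f‖²`, the local bounds add up to a
global one (`norm_ind_comp_le_of_forall_indBall`). -/

namespace CoarseElliptic

/-! ### Multiplication operators and `L²` norms -/

section General

variable {X : Type*} [MeasurableSpace X] {μ : Measure X}

theorem lintegral_sq_le (ν : Measure X) {g : X → ℝ≥0∞} (hg : AEMeasurable g ν) :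
    (∫⁻ y, g y ∂ν) ^ 2 ≤ ν univ * ∫⁻ y, g y ^ 2 ∂ν := by
  have h := ENNReal.lintegral_mul_le_Lp_mul_Lq ν Real.HolderConjugate.two_two
    (f := fun _ => (1 : ℝ≥0∞)) aemeasurable_const hg
  simp only [Pi.mul_apply, one_mul, lintegral_const, ENNReal.rpow_two, one_pow] at h
  have hs : ∀ a : ℝ≥0∞, (a ^ (1 / 2 : ℝ)) ^ 2 = a := fun a => by
    rw [← ENNReal.rpow_two, ← ENNReal.rpow_mul]; norm_num
  calc (∫⁻ y, g y ∂ν) ^ 2 ≤ (ν univ ^ (1 / 2 : ℝ) * (∫⁻ y, g y ^ 2 ∂ν) ^ (1 / 2 : ℝ)) ^ 2 := by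
        gcongr
    _ = _ := by rw [mul_pow, hs, hs]

theorem enorm_sq_eq_lintegral (f : L2 μ) : ‖f‖ₑ ^ 2 = ∫⁻ x, ‖f x‖ₑ ^ 2 ∂μ := by
  rw [Lp.enorm_def]
  have h := eLpNorm_nnreal_pow_eq_lintegral (f := (f : X → ℂ)) (μ := μ) (p := 2) two_ne_zero
  simpa using h

theorem ind_coe {A : Set X} (hA : MeasurableSet A) (f : L2 μ) :
    (ind μ hA f : X → ℂ) =ᵐ[μ] A.indicator (f : X → ℂ) := indFun_coe hA f

theorem ind_norm_le_one {A : Set X} (hA : MeasurableSet A) : ‖ind μ hA‖ ≤ 1 :=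
  LinearMap.mkContinuous_norm_le _ zero_le_one _

theorem enorm_ind_sq {A : Set X} (hA : MeasurableSet A) (f : L2 μ) :
    ‖ind μ hA f‖ₑ ^ 2 = ∫⁻ x in A, ‖f x‖ₑ ^ 2 ∂μ := by
  rw [enorm_sq_eq_lintegral, ← lintegral_indicator hA]
  refine lintegral_congr_ae ?_
  filter_upwards [ind_coe hA f] with x hx
  rw [hx]
  by_cases h : x ∈ A <;> simp [h]

theorem ind_comp_ind_of_subset {A B : Set X} (hA : MeasurableSet A) (hB : MeasurableSet B)
    (h : A ⊆ B) : ind μ hB ∘L ind μ hA = ind μ hA := by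
  ext1 f
  apply Lp.ext
  filter_upwards [ind_coe hB (ind μ hA f), ind_coe hA f] with x h1 h2
  rw [ContinuousLinearMap.comp_apply, h1, h2]
  by_cases hx : x ∈ A
  · rw [indicator_of_mem (h hx), h2]
  · by_cases hx' : x ∈ B <;> simp [hx, hx', h2]

theorem ind_comp_ind_of_subset' {A B : Set X} (hA : MeasurableSet A) (hB : MeasurableSet B)
    (h : A ⊆ B) : ind μ hA ∘L ind μ hB = ind μ hA := by
  ext1 f
  apply Lp.ext
  filter_upwards [ind_coe hA (ind μ hB f), ind_coe hA f, ind_coe hB f] with x h1 h2 h3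
  rw [ContinuousLinearMap.comp_apply, h1, h2]
  by_cases hx : x ∈ A
  · rw [indicator_of_mem hx, indicator_of_mem hx, h3, indicator_of_mem (h hx)]
  · simp [hx]

theorem norm_ind_comp_le (A : Set X) (hA : MeasurableSet A) (T : Bdd μ) :
    ‖ind μ hA ∘L T‖ ≤ ‖T‖ :=
  (ContinuousLinearMap.opNorm_comp_le _ _).trans
    (mul_le_of_le_one_left (norm_nonneg _) (ind_norm_le_one hA))

theorem norm_comp_ind_le (A : Set X) (hA : MeasurableSet A) (T : Bdd μ) :
    ‖T ∘L ind μ hA‖ ≤ ‖T‖ :=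
  (ContinuousLinearMap.opNorm_comp_le _ _).trans
    (mul_le_of_le_one_right (norm_nonneg _) (ind_norm_le_one hA))

theorem norm_ind_comp_mono {A B : Set X} (hA : MeasurableSet A) (hB : MeasurableSet B)
    (h : A ⊆ B) (T : Bdd μ) : ‖ind μ hA ∘L T‖ ≤ ‖ind μ hB ∘L T‖ := by
  rw [← ind_comp_ind_of_subset' hA hB h, ContinuousLinearMap.comp_assoc]
  exact norm_ind_comp_le A hA _

theorem norm_comp_ind_mono {A B : Set X} (hA : MeasurableSet A) (hB : MeasurableSet B)
    (h : A ⊆ B) (T : Bdd μ) : ‖T ∘L ind μ hA‖ ≤ ‖T ∘L ind μ hB‖ := by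
  rw [← ind_comp_ind_of_subset hA hB h, ← ContinuousLinearMap.comp_assoc]
  exact norm_comp_ind_le A hA _

/-- `L²` norms decompose along the level sets of a measurable map to `ℕ`. -/
theorem tsum_enorm_ind_preimage_sq {ι : X → ℕ} (hι : Measurable ι) (f : L2 μ) :
    ∑' n, ‖ind μ (hι (measurableSet_singleton n)) f‖ₑ ^ 2 = ‖f‖ₑ ^ 2 := by
  simp_rw [enorm_ind_sq]
  rw [← lintegral_iUnion (fun n => hι (measurableSet_singleton n)), enorm_sq_eq_lintegral]
  · have : (⋃ n, ι ⁻¹' {n}) = univ := by ext x; simp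
    rw [this, Measure.restrict_univ]
  · intro i j hij
    exact Disjoint.preimage _ (by simpa using hij)

theorem exists_coeFn_mul {ψ : X → ℝ} (hψ : Measurable ψ) (h1 : ∀ x, ‖ψ x‖ₑ ≤ 1) (f : L2 μ) :
    ∃ g : L2 μ, (g : X → ℂ) =ᵐ[μ] fun x => (ψ x : ℂ) * f x := by
  have hm : MemLp (fun x => (ψ x : ℂ) * f x) 2 μ := by
    refine (Lp.memLp f).mono ?_ (Eventually.of_forall fun x => ?_)
    · exact (Complex.measurable_ofReal.comp hψ).aestronglyMeasurable.mul
        (Lp.aestronglyMeasurable f)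
    · rw [norm_mul, Complex.norm_real]
      refine mul_le_of_le_one_left (norm_nonneg _) ?_
      have := h1 x
      rwa [← ofReal_norm, ENNReal.ofReal_le_one] at this
  exact ⟨hm.toLp _, hm.coeFn_toLp⟩

end General

/-! ### Finite propagation and exchange of sides -/

section Controlled

variable {X : Type*} [MetricSpace X] [MeasurableSpace X] {μ : Measure X}

/-- Finite propagation: `k (x, ·)` lives in the ball of radius `R` about `x`, so only the values of
`f` there matter. -/
theorem IsOp.ae_eq_zero {k : X × X → ℂ} {S : Bdd μ} (hS : IsOp μ k S) {R : ℝ}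
    (hk : ∀ x y, R < dist x y → k (x, y) = 0) {B : Set X} {f : L2 μ}
    (hf : ∀ᵐ y ∂μ, y ∈ B → f y = 0) :
    ∀ᵐ x ∂μ, Metric.closedBall x R ⊆ B → S f x = 0 := by
  filter_upwards [hS f] with x hx hxB
  rw [hx]
  refine integral_eq_zero_of_ae ?_
  filter_upwards [hf] with y hy
  by_cases h : R < dist x y
  · simp [hk x y h]
  · simp [hy (hxB (by rw [Metric.mem_closedBall, dist_comm]; exact not_lt.1 h))]

theorem exists_controlled_approx {T : Bdd μ} (hT : T ∈ ellipticAlgebra μ) {ε : ℝ} (hε : 0 < ε) :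
    ∃ (k : X × X → ℂ) (S : Bdd μ) (R M : ℝ), 0 ≤ R ∧ (∀ p, ‖k p‖ ≤ M) ∧ Continuous k ∧
      (∀ x y, R < dist x y → k (x, y) = 0) ∧ IsOp μ k S ∧ ‖T - S‖ < ε := by
  obtain ⟨S, ⟨k, hk, hS⟩, hd⟩ := Metric.mem_closure_iff.1 hT ε hε
  obtain ⟨R, hR⟩ := hk.controlled
  obtain ⟨M, hM⟩ := hk.bounded
  exact ⟨k, S, max R 0, M, le_max_right _ _, hM, hk.uniformContinuous.continuous,
    fun x y h => hR x y ((le_max_left _ _).trans_lt h), hS, by rwa [← dist_eq_norm]⟩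

variable [BorelSpace X]

theorem IsOp.comp_indBall {k : X × X → ℂ} {S : Bdd μ} (hS : IsOp μ k S) {R : ℝ}
    (hk : ∀ x y, R < dist x y → k (x, y) = 0) (x : X) (r : ℝ) :
    indBall μ x (r + R) ∘L (S ∘L indBall μ x r) = S ∘L indBall μ x r := by
  ext1 f
  apply Lp.ext
  have h0 : ∀ᵐ y ∂μ, y ∈ (Metric.closedBall x r)ᶜ → indBall μ x r f y = 0 := by
    filter_upwards [ind_coe (Metric.isClosed_closedBall (x := x) (ε := r)).measurableSet f]
      with y hy hyB
    exact hy.trans (indicator_of_notMem hyB _)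
  filter_upwards [ind_coe (Metric.isClosed_closedBall (x := x) (ε := r + R)).measurableSet
    (S (indBall μ x r f)), hS.ae_eq_zero hk h0] with a h1 h2
  refine h1.trans ?_
  by_cases ha : a ∈ Metric.closedBall x (r + R)
  · rw [indicator_of_mem ha]; rfl
  · rw [indicator_of_notMem ha]
    refine (h2 fun b hb hb' => ha ?_).symm
    rw [Metric.mem_closedBall] at *
    linarith [dist_triangle a b x, dist_comm a b]

theorem IsOp.indBall_comp {k : X × X → ℂ} {S : Bdd μ} (hS : IsOp μ k S) {R : ℝ}
    (hk : ∀ x y, R < dist x y → k (x, y) = 0) (x : X) (r : ℝ) :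
    (indBall μ x r ∘L S) ∘L indBall μ x (r + R) = indBall μ x r ∘L S := by
  ext1 f
  apply Lp.ext
  have h0 : ∀ᵐ y ∂μ, y ∈ Metric.closedBall x (r + R) →
      (f - indBall μ x (r + R) f) y = 0 := by
    filter_upwards [ind_coe (Metric.isClosed_closedBall (x := x) (ε := r + R)).measurableSet f,
      Lp.coeFn_sub f (indBall μ x (r + R) f)] with y hy hy' hyB
    rw [hy', Pi.sub_apply, sub_eq_zero]
    exact (hy.trans (indicator_of_mem hyB _)).symm
  filter_upwards [ind_coe (Metric.isClosed_closedBall (x := x) (ε := r)).measurableSet (S f),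
    ind_coe (Metric.isClosed_closedBall (x := x) (ε := r)).measurableSet
      (S (indBall μ x (r + R) f)), hS.ae_eq_zero hk h0,
    Lp.coeFn_sub (S f) (S (indBall μ x (r + R) f))] with a h1 h2 h3 h4
  refine h2.trans (Eq.trans ?_ h1.symm)
  by_cases ha : a ∈ Metric.closedBall x r
  · rw [indicator_of_mem ha, indicator_of_mem ha]
    have : Metric.closedBall a R ⊆ Metric.closedBall x (r + R) := fun b hb => by
      rw [Metric.mem_closedBall] at *
      linarith [dist_triangle b a x]
    have h5 := h3 this
    rw [map_sub, h4, Pi.sub_apply, sub_eq_zero] at h5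
    exact h5.symm
  · rw [indicator_of_notMem ha, indicator_of_notMem ha]

/-- The larger ball absorbs `S 1_B`, so replacing `T` by `S` and then `S` by `T` leaves two error
terms, each at most `‖T - S‖`. -/
theorem norm_comp_indBall_le {k : X × X → ℂ} {S T : Bdd μ} (hS : IsOp μ k S) {R : ℝ}
    (hk : ∀ x y, R < dist x y → k (x, y) = 0) (x : X) (r : ℝ) :
    ‖T ∘L indBall μ x r‖ ≤ 2 * ‖T - S‖ + ‖indBall μ x (r + R) ∘L T‖ := by
  have e : T ∘L indBall μ x r = (T - S) ∘L indBall μ x r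
      - (indBall μ x (r + R) ∘L (T - S)) ∘L indBall μ x r
      + (indBall μ x (r + R) ∘L T) ∘L indBall μ x r := by
    have := hS.comp_indBall hk x r
    simp only [ContinuousLinearMap.comp_sub, ContinuousLinearMap.sub_comp,
      ContinuousLinearMap.comp_assoc, this]
    abel
  rw [e]
  have h1 := norm_comp_ind_le (μ := μ) _ (Metric.isClosed_closedBall (x := x) (ε := r)).measurableSet
    (T - S)
  have h2 := norm_comp_ind_le (μ := μ) _ (Metric.isClosed_closedBall (x := x) (ε := r)).measurableSet
    (indBall μ x (r + R) ∘L (T - S))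
  have h3 := norm_ind_comp_le (μ := μ) _
    (Metric.isClosed_closedBall (x := x) (ε := r + R)).measurableSet (T - S)
  have h4 := norm_comp_ind_le (μ := μ) _ (Metric.isClosed_closedBall (x := x) (ε := r)).measurableSet
    (indBall μ x (r + R) ∘L T)
  refine (norm_add_le _ _).trans ?_
  have h5 := norm_sub_le ((T - S) ∘L indBall μ x r)
    ((indBall μ x (r + R) ∘L (T - S)) ∘L indBall μ x r)
  unfold indBall at *
  linarith

theorem norm_indBall_comp_le {k : X × X → ℂ} {S T : Bdd μ} (hS : IsOp μ k S) {R : ℝ}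
    (hk : ∀ x y, R < dist x y → k (x, y) = 0) (x : X) (r : ℝ) :
    ‖indBall μ x r ∘L T‖ ≤ 2 * ‖T - S‖ + ‖T ∘L indBall μ x (r + R)‖ := by
  have e : indBall μ x r ∘L T = indBall μ x r ∘L (T - S)
      - indBall μ x r ∘L ((T - S) ∘L indBall μ x (r + R))
      + indBall μ x r ∘L (T ∘L indBall μ x (r + R)) := by
    have := hS.indBall_comp hk x r
    rw [ContinuousLinearMap.comp_assoc] at this
    simp only [ContinuousLinearMap.comp_sub, ContinuousLinearMap.sub_comp, this]
    abel
  rw [e]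
  have h1 := norm_ind_comp_le (μ := μ) _ (Metric.isClosed_closedBall (x := x) (ε := r)).measurableSet
    (T - S)
  have h2 := norm_ind_comp_le (μ := μ) _ (Metric.isClosed_closedBall (x := x) (ε := r)).measurableSet
    ((T - S) ∘L indBall μ x (r + R))
  have h3 := norm_comp_ind_le (μ := μ) _
    (Metric.isClosed_closedBall (x := x) (ε := r + R)).measurableSet (T - S)
  have h4 := norm_ind_comp_le (μ := μ) _ (Metric.isClosed_closedBall (x := x) (ε := r)).measurableSet
    (T ∘L indBall μ x (r + R))
  refine (norm_add_le _ _).trans ?_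
  have h5 := norm_sub_le (indBall μ x r ∘L (T - S))
    (indBall μ x r ∘L ((T - S) ∘L indBall μ x (r + R)))
  unfold indBall at *
  linarith

theorem tendsto_comp_indBall_iff {T : Bdd μ} (hT : T ∈ ellipticAlgebra μ) (ξ : Filter X) :
    (∀ r : ℝ, 0 < r → Tendsto (fun x => ‖T ∘L indBall μ x r‖) ξ (𝓝 0)) ↔
      ∀ r : ℝ, 0 < r → Tendsto (fun x => ‖indBall μ x r ∘L T‖) ξ (𝓝 0) := by
  constructor <;> intro h r hr <;> rw [Metric.tendsto_nhds] <;> intro ε hε <;>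
    obtain ⟨k, S, R, M, hR, -, -, hk, hS, hTS⟩ := exists_controlled_approx hT
      (show 0 < ε / 4 by positivity) <;>
    filter_upwards [Metric.tendsto_nhds.1 (h (r + R) (by positivity)) (ε / 2) (by positivity)]
      with x hx <;>
    rw [dist_zero_right, norm_norm] at *
  · linarith [norm_indBall_comp_le (T := T) hS hk x r]
  · linarith [norm_comp_indBall_le (T := T) hS hk x r]

end Controlled

/-! ### Discretization of Property A -/

/-- Property A in discretized form: a countable partition of unity, in the `ℓ²` sense, by functions
with uniformly bounded supports and small variation. -/
theorem HasPropertyA.exists_partition {X : Type*} [MetricSpace X] [MeasurableSpace X]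
    [BorelSpace X] {μ : Measure X} [SecondCountableTopology X] [Nonempty X]
    (h : HasPropertyA μ) {η r : ℝ} (hη : 0 < η) (hr : 0 < r) :
    ∃ (ψ : ℕ → X → ℝ) (c : ℕ → X) (s : ℝ), 0 ≤ s ∧ (∀ n, Measurable (ψ n)) ∧
      (∀ x, ∑' n, ‖ψ n x‖ₑ ^ 2 = 1) ∧
      (∀ x y, dist x y < r → ∑' n, ‖ψ n x - ψ n y‖ₑ ^ 2 ≤ ENNReal.ofReal η ^ 2) ∧
      ∀ n x, s < dist x (c n) → ψ n x = 0 := by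
  classical
  obtain ⟨φ, hφm, hφ1, ⟨s, hs⟩, hφ⟩ := h η hη r hr
  let d := TopologicalSpace.denseSeq X
  have hd : ∀ x : X, ∃ n, dist x (d n) < 1 := fun x =>
    (TopologicalSpace.denseRange_denseSeq X).exists_dist_lt x one_pos
  let ι : X → ℕ := fun x => Nat.find (hd x)
  have hι : Measurable ι := measurable_find hd fun n =>
    measurableSet_lt (measurable_id.dist measurable_const) measurable_const
  have hιd : ∀ x, dist x (d (ι x)) < 1 := fun x => Nat.find_spec (hd x)
  -- The level sets of `ι` cut the space into measurable pieces, the `n`-th within distance 1 of `d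
  -- n`. The weights are the `L²` norms of `φ x` on the pieces; their squares add up to `‖φ x‖² =
  -- 1`, and the reverse triangle inequality transfers the variation bound of `φ`.
  let E : ℕ → Bdd μ := fun n => ind μ (hι (measurableSet_singleton n))
  refine ⟨fun n x => ‖E n (φ x)‖, d, max s 0 + 1, by positivity, fun n => ?_, fun x => ?_,
    fun x y hxy => ?_, fun n x hx => ?_⟩
  · let _ : MeasurableSpace (L2 μ) := borel _
    have : BorelSpace (L2 μ) := ⟨rfl⟩
    exact (E n).continuous.norm.measurable.comp hφm
  · simp only [enorm_norm]
    rw [tsum_enorm_ind_preimage_sq hι, ← ofReal_norm, hφ1]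
    simp
  · have h1 : ∀ n, ‖‖E n (φ x)‖ - ‖E n (φ y)‖‖ₑ ≤ ‖E n (φ x - φ y)‖ₑ := fun n => by
      rw [← ofReal_norm, ← ofReal_norm, map_sub, Real.norm_eq_abs]
      exact ENNReal.ofReal_le_ofReal (abs_norm_sub_norm_le _ _)
    calc ∑' n, ‖‖E n (φ x)‖ - ‖E n (φ y)‖‖ₑ ^ 2 ≤ ∑' n, ‖E n (φ x - φ y)‖ₑ ^ 2 :=
          ENNReal.tsum_le_tsum fun n => by gcongr; exact h1 n
      _ = ‖φ x - φ y‖ₑ ^ 2 := tsum_enorm_ind_preimage_sq hι _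
      _ ≤ _ := by
          rw [← ofReal_norm]
          gcongr
          exact (hφ x y hxy).le
  · rw [norm_eq_zero]
    apply Lp.ext
    filter_upwards [ind_coe (hι (measurableSet_singleton n)) (φ x), hs x, Lp.coeFn_zero ℂ 2 μ]
      with y h1 h2 h3
    rw [h1, h3]
    refine indicator_apply_eq_zero.2 fun hy => h2 fun hyx => ?_
    have hy' : ι y = n := hy
    have := hιd y
    rw [hy'] at this
    rw [Metric.mem_closedBall] at hyx
    linarith [dist_triangle x y (d n), dist_comm x y, le_max_left s 0]

/-! ### Commutator estimates and the passage from local to global bounds -/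

section Commutator

variable {X : Type*} [MetricSpace X] [MeasurableSpace X] [BorelSpace X] {μ : Measure X}

theorem integrable_kernel_mul {k : X × X → ℂ} {R M : ℝ} (hkc : Continuous k)
    (hkM : ∀ p, ‖k p‖ ≤ M) (hk : ∀ x y, R < dist x y → k (x, y) = 0) (f : L2 μ) (x : X)
    (hx : μ (Metric.closedBall x R) ≠ ∞) : Integrable (fun y => k (x, y) * f y) μ := by
  have hfin : IsFiniteMeasure (μ.restrict (Metric.closedBall x R)) :=
    ⟨by rw [Measure.restrict_apply_univ]; exact hx.lt_top⟩
  have h1 : IntegrableOn f (Metric.closedBall x R) μ :=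
    ((Lp.memLp f).restrict _).integrable one_le_two
  have h2 : IntegrableOn (fun y => k (x, y) * f y) (Metric.closedBall x R) μ :=
    h1.bdd_mul (c := M) (hkc.comp (Continuous.prodMk_right x)).aestronglyMeasurable
      (Eventually.of_forall fun y => hkM _)
  refine (integrableOn_iff_integrable_of_support_subset fun y hy => ?_).1 h2
  by_contra hyx
  rw [Metric.mem_closedBall, dist_comm, not_le] at hyx
  exact hy (by simp [hk x y hyx])

variable [SecondCountableTopology X] [SFinite μ]

/-- By Tonelli and the symmetry of the distance, each `g y` is counted with weight the volume of the
ball about `y`. -/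
theorem lintegral_lintegral_closedBall_le {R : ℝ} {V : ℝ≥0∞}
    (hV : ∀ x, μ (Metric.closedBall x R) ≤ V) {g : X → ℝ≥0∞} (hg : Measurable g) :
    ∫⁻ x, ∫⁻ y in Metric.closedBall x R, g y ∂μ ∂μ ≤ V * ∫⁻ y, g y ∂μ := by
  have hset : MeasurableSet {p : X × X | dist p.1 p.2 ≤ R} :=
    (isClosed_le continuous_dist continuous_const).measurableSet
  have e1 : ∀ x, ∫⁻ y in Metric.closedBall x R, g y ∂μ
      = ∫⁻ y, {p : X × X | dist p.1 p.2 ≤ R}.indicator (fun p => g p.2) (x, y) ∂μ := fun x => by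
    rw [← lintegral_indicator Metric.isClosed_closedBall.measurableSet]
    refine lintegral_congr fun y => ?_
    by_cases h : dist x y ≤ R <;> simp [indicator, dist_comm y x, h]
  have e2 : ∀ y, ∫⁻ x, {p : X × X | dist p.1 p.2 ≤ R}.indicator (fun p => g p.2) (x, y) ∂μ
      = g y * μ (Metric.closedBall y R) := fun y => by
    rw [← setLIntegral_const, ← lintegral_indicator Metric.isClosed_closedBall.measurableSet]
    refine lintegral_congr fun x => ?_
    by_cases h : dist x y ≤ R <;> simp [indicator, h]
  simp_rw [e1]
  rw [lintegral_lintegral_swap (f := fun x y =>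
    {p : X × X | dist p.1 p.2 ≤ R}.indicator (fun p => g p.2) (x, y)) ((hg.comp measurable_snd).indicator hset).aemeasurable]
  simp_rw [e2]
  rw [mul_comm V, ← lintegral_mul_const _ hg]
  exact lintegral_mono fun y => by gcongr; exact hV y

/-- The commutators of a controlled integral operator with a partition of unity of small variation
are small in the square mean. -/
theorem tsum_lintegral_commutator_le {k : X × X → ℂ} {R M : ℝ} (hkM : ∀ p, ‖k p‖ ≤ M)
    (hk : ∀ x y, R < dist x y → k (x, y) = 0) {V η : ℝ≥0∞}
    (hV : ∀ x, μ (Metric.closedBall x R) ≤ V) (hVfin : V ≠ ∞) (hη : η ≠ ∞) {ψ : ℕ → X → ℝ} (hψm : ∀ n, Measurable (ψ n))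
    (hψ : ∀ x y, dist x y ≤ R → ∑' n, ‖ψ n x - ψ n y‖ₑ ^ 2 ≤ η ^ 2) (f : L2 μ) :
    ∫⁻ x, ∑' n, ‖∫ y, k (x, y) * (((ψ n x - ψ n y : ℝ) : ℂ) * f y) ∂μ‖ₑ ^ 2 ∂μ
      ≤ (ENNReal.ofReal M * V * η) ^ 2 * ‖f‖ₑ ^ 2 := by
  have hfm : Measurable fun y => ‖f y‖ₑ := (Lp.stronglyMeasurable f).measurable.enorm
  -- Cauchy–Schwarz on the ball costs one factor `V`; the second factor in `V ^ 2` comes from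
  -- integrating over `x` by Tonelli.
  have key : ∀ n x, ‖∫ y, k (x, y) * (((ψ n x - ψ n y : ℝ) : ℂ) * f y) ∂μ‖ₑ ^ 2 ≤
      ENNReal.ofReal M ^ 2 * (V * ∫⁻ y in Metric.closedBall x R,
        (‖ψ n x - ψ n y‖ₑ * ‖f y‖ₑ) ^ 2 ∂μ) := by
    intro n x
    have hm : Measurable fun y => ‖ψ n x - ψ n y‖ₑ * ‖f y‖ₑ :=
      (measurable_const.sub (hψm n)).enorm.mul hfm
    have h1 : ‖∫ y, k (x, y) * (((ψ n x - ψ n y : ℝ) : ℂ) * f y) ∂μ‖ₑ ≤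
        ENNReal.ofReal M * ∫⁻ y in Metric.closedBall x R, ‖ψ n x - ψ n y‖ₑ * ‖f y‖ₑ ∂μ := by
      refine (enorm_integral_le_lintegral_enorm _).trans ?_
      rw [← lintegral_const_mul _ hm,
        ← lintegral_indicator Metric.isClosed_closedBall.measurableSet]
      refine lintegral_mono fun y => ?_
      by_cases hy : y ∈ Metric.closedBall x R
      · rw [indicator_of_mem hy, enorm_mul, enorm_mul]
        have h2 : ‖k (x, y)‖ₑ ≤ ENNReal.ofReal M := by
          rw [← ofReal_norm]; exact ENNReal.ofReal_le_ofReal (hkM _)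
        have h3 : ‖((ψ n x - ψ n y : ℝ) : ℂ)‖ₑ = ‖ψ n x - ψ n y‖ₑ := by
          rw [← ofReal_norm, ← ofReal_norm, Complex.norm_real]
        rw [h3]
        gcongr
      · rw [Metric.mem_closedBall, dist_comm, not_le] at hy
        simp [hk x y hy]
    refine (pow_le_pow_left' h1 2).trans ?_
    rw [mul_pow]
    gcongr
    refine (lintegral_sq_le _ hm.aemeasurable).trans ?_
    rw [Measure.restrict_apply_univ]
    gcongr
    exact hV x
  have key2 : ∀ x, ∑' n, ‖∫ y, k (x, y) * (((ψ n x - ψ n y : ℝ) : ℂ) * f y) ∂μ‖ₑ ^ 2 ≤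
      ENNReal.ofReal M ^ 2 * V * η ^ 2 * ∫⁻ y in Metric.closedBall x R, ‖f y‖ₑ ^ 2 ∂μ := by
    intro x
    have hm : ∀ n, Measurable fun y => (‖ψ n x - ψ n y‖ₑ * ‖f y‖ₑ) ^ 2 := fun n =>
      ((measurable_const.sub (hψm n)).enorm.mul hfm).pow_const 2
    refine (ENNReal.tsum_le_tsum fun n => key n x).trans ?_
    rw [ENNReal.tsum_mul_left, ENNReal.tsum_mul_left, ← lintegral_tsum fun n =>
      (hm n).aemeasurable, mul_assoc, mul_assoc]
    gcongr
    rw [← lintegral_const_mul _ (hfm.pow_const 2)]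
    refine setLIntegral_mono ((hfm.pow_const 2).const_mul _) fun y hy => ?_
    simp_rw [mul_pow]
    rw [ENNReal.tsum_mul_right]
    gcongr
    refine hψ x y ?_
    rwa [dist_comm]
  refine (lintegral_mono key2).trans ?_
  rw [lintegral_const_mul', enorm_sq_eq_lintegral]
  · refine (mul_le_mul_right (lintegral_lintegral_closedBall_le hV (hfm.pow_const 2)) _).trans ?_
    apply le_of_eq; ring
  · finiteness

/-- Since `∑ ψ_n² = 1`, `|S f|²` is the sum of the `|ψ_n S f|²`. Commuting `ψ_n` past `S` splits
each term in two, with the factor 2 from `(a + b)² ≤ 2a² + 2b²`. -/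
theorem enorm_ind_apply_sq_le {k : X × X → ℂ} {S : Bdd μ} (hS : IsOp μ k S) {R M : ℝ}
    (hkc : Continuous k) (hkM : ∀ p, ‖k p‖ ≤ M) (hk : ∀ x y, R < dist x y → k (x, y) = 0)
    {V η : ℝ≥0∞} (hV : ∀ x, μ (Metric.closedBall x R) ≤ V) (hVfin : V ≠ ∞) (hη : η ≠ ∞)
    {ψ : ℕ → X → ℝ} (hψm : ∀ n, Measurable (ψ n)) (hψ1 : ∀ x, ∑' n, ‖ψ n x‖ₑ ^ 2 = 1)
    (hψ : ∀ x y, dist x y ≤ R → ∑' n, ‖ψ n x - ψ n y‖ₑ ^ 2 ≤ η ^ 2) {f : L2 μ} {g : ℕ → L2 μ}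
    (hg : ∀ n, (g n : X → ℂ) =ᵐ[μ] fun x => (ψ n x : ℂ) * f x) {F : Set X}
    (hF : MeasurableSet F) :
    ‖ind μ hF (S f)‖ₑ ^ 2 ≤ 2 * ∑' n, ‖ind μ hF (S (g n))‖ₑ ^ 2 +
      2 * ((ENNReal.ofReal M * V * η) ^ 2 * ‖f‖ₑ ^ 2) := by
  let h : ℕ → X → ℂ := fun n x => ∫ y, k (x, y) * (((ψ n x - ψ n y : ℝ) : ℂ) * f y) ∂μ
  have hdec : ∀ n, ∀ᵐ x ∂μ, (ψ n x : ℂ) * S f x = S (g n) x + h n x := by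
    intro n
    filter_upwards [hS f, hS (g n)] with x h1 h2
    have hx : μ (Metric.closedBall x R) ≠ ∞ := ((hV x).trans_lt hVfin.lt_top).ne
    have h3 : ∫ y, k (x, y) * g n y ∂μ = ∫ y, k (x, y) * ((ψ n y : ℂ) * f y) ∂μ := by
      refine integral_congr_ae ?_
      filter_upwards [hg n] with y hy
      rw [hy]
    have h4 : Integrable (fun y => k (x, y) * ((ψ n y : ℂ) * f y)) μ := by
      refine (integrable_kernel_mul hkc hkM hk (g n) x hx).congr ?_
      filter_upwards [hg n] with y hy
      rw [hy]
    have h5 := (integrable_kernel_mul hkc hkM hk f x hx).const_mul (ψ n x : ℂ)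
    have h6 : h n x = (ψ n x : ℂ) * (∫ y, k (x, y) * f y ∂μ) -
        ∫ y, k (x, y) * ((ψ n y : ℂ) * f y) ∂μ := by
      rw [← integral_const_mul, ← integral_sub h5 h4]
      refine integral_congr_ae (Eventually.of_forall fun y => ?_)
      push_cast
      ring
    rw [h6, h1, h2, h3]
    ring
  have hpt : ∀ᵐ x ∂μ, ‖S f x‖ₑ ^ 2 ≤
      2 * ∑' n, ‖S (g n) x‖ₑ ^ 2 + 2 * ∑' n, ‖h n x‖ₑ ^ 2 := by
    filter_upwards [ae_all_iff.2 hdec] with x hx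
    have e : ∀ n, ‖ψ n x‖ₑ ^ 2 * ‖S f x‖ₑ ^ 2 ≤ 2 * ‖S (g n) x‖ₑ ^ 2 + 2 * ‖h n x‖ₑ ^ 2 := by
      intro n
      have h3 : ‖ψ n x‖ₑ = ‖(ψ n x : ℂ)‖ₑ := by
        rw [← ofReal_norm, ← ofReal_norm, Complex.norm_real]
      rw [← mul_pow, h3, ← enorm_mul, hx n]
      refine (pow_le_pow_left' (enorm_add_le _ _) 2).trans ?_
      have := ENNReal.rpow_add_le_mul_rpow_add_rpow ‖S (g n) x‖ₑ ‖h n x‖ₑ (p := 2) one_le_two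
      norm_num [ENNReal.rpow_two] at this
      rwa [← mul_add]
    calc ‖S f x‖ₑ ^ 2 = ∑' n, ‖ψ n x‖ₑ ^ 2 * ‖S f x‖ₑ ^ 2 := by
          rw [ENNReal.tsum_mul_right, hψ1, one_mul]
      _ ≤ ∑' n, (2 * ‖S (g n) x‖ₑ ^ 2 + 2 * ‖h n x‖ₑ ^ 2) := ENNReal.tsum_le_tsum e
      _ = _ := by rw [ENNReal.tsum_add, ENNReal.tsum_mul_left, ENNReal.tsum_mul_left]
  have hm : ∀ n, Measurable fun x => ‖S (g n) x‖ₑ ^ 2 := fun n =>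
    (Lp.stronglyMeasurable _).measurable.enorm.pow_const 2
  simp_rw [enorm_ind_sq]
  calc ∫⁻ x in F, ‖S f x‖ₑ ^ 2 ∂μ
      ≤ ∫⁻ x in F, (2 * ∑' n, ‖S (g n) x‖ₑ ^ 2 + 2 * ∑' n, ‖h n x‖ₑ ^ 2) ∂μ :=
        lintegral_mono_ae (ae_restrict_of_ae hpt)
    _ = 2 * ∑' n, ∫⁻ x in F, ‖S (g n) x‖ₑ ^ 2 ∂μ + 2 * ∫⁻ x in F, ∑' n, ‖h n x‖ₑ ^ 2 ∂μ := by
        rw [lintegral_add_left ((Measurable.tsum hm).const_mul 2),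
          lintegral_const_mul' _ _ (by simp), lintegral_const_mul' _ _ (by simp),
          lintegral_tsum fun n => (hm n).aemeasurable]
    _ ≤ _ := by
        gcongr
        exact (setLIntegral_le_lintegral _ _).trans
          (tsum_lintegral_commutator_le hkM hk hV hVfin hη hψm hψ f)

/-- A controlled integral operator which is uniformly small on the balls centered in `F` is small
on `F`. -/
theorem norm_ind_comp_le_of_forall_indBall {k : X × X → ℂ} {S : Bdd μ} (hS : IsOp μ k S)
    {R M s a : ℝ} (hkc : Continuous k) (hkM : ∀ p, ‖k p‖ ≤ M)
    (hk : ∀ x y, R < dist x y → k (x, y) = 0)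
    {V η : ℝ≥0∞} (hV : ∀ x, μ (Metric.closedBall x R) ≤ V) (hVfin : V ≠ ∞) (hη : η ≠ ∞)
    {ψ : ℕ → X → ℝ} {c : ℕ → X} (hψm : ∀ n, Measurable (ψ n))
    (hψ1 : ∀ x, ∑' n, ‖ψ n x‖ₑ ^ 2 = 1)
    (hψ : ∀ x y, dist x y ≤ R → ∑' n, ‖ψ n x - ψ n y‖ₑ ^ 2 ≤ η ^ 2)
    (hψs : ∀ n x, s < dist x (c n) → ψ n x = 0) (ha : 0 ≤ a)
    (hη_le : ENNReal.ofReal M * V * η ≤ ENNReal.ofReal a) {F : Set X} (hF : MeasurableSet F)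
    (hSF : ∀ z ∈ F, ‖S ∘L indBall μ z (R + 2 * s)‖ ≤ a) : ‖ind μ hF ∘L S‖ ≤ 2 * a := by
  refine ContinuousLinearMap.opNorm_le_bound _ (by positivity) fun f => ?_
  have hψ_le : ∀ n x, ‖ψ n x‖ₑ ≤ 1 := fun n x => by
    have := (ENNReal.le_tsum n).trans (hψ1 x).le
    exact (ENNReal.pow_le_pow_left_iff two_ne_zero).1 (by simpa using this)
  choose g hg using fun n => exists_coeFn_mul (hψm n) (hψ_le n) f
  have hsum : ∑' n, ‖g n‖ₑ ^ 2 = ‖f‖ₑ ^ 2 := by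
    simp_rw [enorm_sq_eq_lintegral]
    rw [← lintegral_tsum fun n =>
      ((Lp.stronglyMeasurable (g n)).measurable.enorm.pow_const 2).aemeasurable]
    refine lintegral_congr_ae ?_
    filter_upwards [ae_all_iff.2 hg] with x hx
    have h3 : ∀ n, ‖ψ n x‖ₑ = ‖(ψ n x : ℂ)‖ₑ := fun n => by
      rw [← ofReal_norm, ← ofReal_norm, Complex.norm_real]
    simp_rw [hx, enorm_mul, mul_pow, ← h3]
    rw [ENNReal.tsum_mul_right, hψ1, one_mul]
  have hloc : ∀ n, ‖ind μ hF (S (g n))‖ ≤ a * ‖g n‖ := by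
    intro n
    have hg0 : ∀ᵐ y ∂μ, y ∈ (Metric.closedBall (c n) s)ᶜ → g n y = 0 := by
      filter_upwards [hg n] with y hy hyc
      rw [mem_compl_iff, Metric.mem_closedBall, not_le] at hyc
      rw [hy, hψs n y hyc]
      simp
    -- `S (g n)` lives in the ball of radius `R + s` about `c n`. If `F` meets that ball at `z`, the
    -- support of `g n` lies within `R + 2 * s` of `z`; otherwise `1_F` kills `S (g n)`.
    by_cases hz : ∃ z ∈ F, dist z (c n) ≤ R + s
    · obtain ⟨z, hzF, hz⟩ := hz
      have e : indBall μ z (R + 2 * s) (g n) = g n := by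
        apply Lp.ext
        filter_upwards [hg0,
          ind_coe (Metric.isClosed_closedBall (x := z) (ε := R + 2 * s)).measurableSet (g n)]
          with y h1 h2
        refine h2.trans ?_
        by_cases hy : y ∈ Metric.closedBall z (R + 2 * s)
        · rw [indicator_of_mem hy]
        · rw [indicator_of_notMem hy, h1 fun hyc => hy ?_]
          rw [Metric.mem_closedBall] at *
          linarith [dist_triangle y (c n) z, dist_comm z (c n)]
      calc ‖ind μ hF (S (g n))‖ ≤ 1 * ‖S (g n)‖ := indFun_norm_le hF _
        _ = ‖(S ∘L indBall μ z (R + 2 * s)) (g n)‖ := by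
          rw [one_mul, ContinuousLinearMap.comp_apply, e]
        _ ≤ _ := ContinuousLinearMap.le_of_opNorm_le _ (hSF z hzF) _
    · push Not at hz
      have e : ind μ hF (S (g n)) = 0 := by
        apply Lp.ext
        filter_upwards [hS.ae_eq_zero hk hg0, ind_coe hF (S (g n)), Lp.coeFn_zero ℂ 2 μ]
          with x h1 h2 h3
        rw [h2, h3]
        refine indicator_apply_eq_zero.2 fun hx => h1 fun y hy hyc => ?_
        rw [Metric.mem_closedBall] at *
        linarith [dist_triangle x y (c n), dist_comm x y, hz x hx]
      rw [e, norm_zero]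
      positivity
  have hloc' : ∀ n, ‖ind μ hF (S (g n))‖ₑ ^ 2 ≤ ENNReal.ofReal a ^ 2 * ‖g n‖ₑ ^ 2 := fun n => by
    rw [← mul_pow, ← ofReal_norm, ← ofReal_norm, ← ENNReal.ofReal_mul ha]
    gcongr
    exact hloc n
  have hmain : ‖ind μ hF (S f)‖ₑ ^ 2 ≤ (ENNReal.ofReal (2 * a * ‖f‖)) ^ 2 := by
    refine (enorm_ind_apply_sq_le hS hkc hkM hk hV hVfin hη hψm hψ1 hψ hg hF).trans ?_
    calc _ ≤ 2 * (ENNReal.ofReal a ^ 2 * ‖f‖ₑ ^ 2) + 2 * (ENNReal.ofReal a ^ 2 * ‖f‖ₑ ^ 2) := by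
          gcongr
          rw [← hsum, ← ENNReal.tsum_mul_left]
          exact ENNReal.tsum_le_tsum hloc'
      _ = _ := by
          rw [ENNReal.ofReal_mul (by positivity), ENNReal.ofReal_mul zero_le_two, ofReal_norm,
            ENNReal.ofReal_ofNat]
          ring
  rw [← ofReal_norm] at hmain
  have := (ENNReal.pow_le_pow_left_iff two_ne_zero).1 hmain
  exact (ENNReal.ofReal_le_ofReal_iff (by positivity)).1 this

end Commutator

/-! ### The ideals and the coarse envelope -/

section Main

variable {X : Type*} [MetricSpace X] [MeasurableSpace X] {μ : Measure X}

theorem mem_idealJ_iff {T : Bdd μ} (hT : T ∈ ellipticAlgebra μ) {ξ : Filter X} :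
    T ∈ idealJ μ ξ ↔
      ∀ ε : ℝ, 0 < ε → ∃ F ∈ ξ, ∃ hF : MeasurableSet F, ‖ind μ hF ∘L T‖ < ε := by
  have : Nonempty {F : Set X // F ∈ ξ ∧ MeasurableSet F} :=
    ⟨⟨univ, univ_mem, MeasurableSet.univ⟩⟩
  have hbdd : BddBelow (range fun F : {F : Set X // F ∈ ξ ∧ MeasurableSet F} =>
      ‖ind μ F.2.2 ∘L T‖) := ⟨0, by rintro _ ⟨F, rfl⟩; exact norm_nonneg _⟩
  constructor
  · rintro ⟨-, h⟩ ε hε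
    obtain ⟨⟨F, hFξ, hF⟩, hlt⟩ := exists_lt_of_ciInf_lt (h.trans_lt hε)
    exact ⟨F, hFξ, hF, hlt⟩
  · refine fun h => ⟨hT, le_antisymm (le_of_forall_pos_lt_add fun ε hε => ?_)
      (le_ciInf fun F => norm_nonneg _)⟩
    obtain ⟨F, hFξ, hF, hlt⟩ := h ε hε
    rw [zero_add]
    exact (ciInf_le hbdd ⟨F, hFξ, hF⟩).trans_lt hlt

variable [BorelSpace X]

/-- The points around which `T` is small on balls of a given radius form a set of the coarse
envelope. -/
theorem interior_setOf_norm_comp_indBall_le_mem {T : Bdd μ} {ξ : Filter X}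
    (h : ∀ r : ℝ, 0 < r → Tendsto (fun x => ‖T ∘L indBall μ x r‖) ξ (𝓝 0)) {δ t : ℝ}
    (hδ : 0 < δ) (ht : 0 ≤ t) :
    interior {x | ‖T ∘L indBall μ x t‖ ≤ δ} ∈ coarseEnvelope ξ := by
  refine ((coarseEnvelope_spec ξ).2 _).2 fun r hr => ?_
  -- The excess over `t` is `r + 1` for the ball that must lie in the interior, plus 1 for the open
  -- ball witnessing interiority. The interior is taken so that the set is measurable.
  filter_upwards [(h (t + r + 2) (by positivity)).eventually_lt_const hδ] with x hx
  refine ⟨r + 1, by linarith, fun y hy => mem_interior.2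
    ⟨Metric.ball y 1, fun z hz => ?_, Metric.isOpen_ball, Metric.mem_ball_self one_pos⟩⟩
  refine (norm_comp_ind_mono _ _ ?_ T).trans hx.le
  refine Metric.closedBall_subset_closedBall' ?_
  rw [Metric.mem_closedBall] at hy
  rw [Metric.mem_ball] at hz
  linarith [dist_triangle z y x]

theorem tendsto_indBall_comp_of_mem_idealJ {T : Bdd μ} {ξ : Filter X}
    (h : T ∈ idealJ μ (coarseEnvelope ξ)) (r : ℝ) (hr : 0 < r) :
    Tendsto (fun x => ‖indBall μ x r ∘L T‖) ξ (𝓝 0) := by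
  rw [Metric.tendsto_nhds]
  intro ε hε
  obtain ⟨F, hFξ, hF, hlt⟩ := (mem_idealJ_iff h.1).1 h ε hε
  filter_upwards [((coarseEnvelope_spec ξ).2 F).1 hFξ r hr] with x hx
  obtain ⟨r', hr', hsub⟩ := hx
  rw [dist_zero_right, norm_norm]
  exact (norm_ind_comp_mono _ hF
    ((Metric.closedBall_subset_closedBall hr'.le).trans hsub) T).trans_lt hlt

theorem mem_idealJ_of_tendsto_comp_indBall (hX : IsClassA μ) {T : Bdd μ}
    (hT : T ∈ ellipticAlgebra μ) {ξ : Filter X}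
    (h : ∀ r : ℝ, 0 < r → Tendsto (fun x => ‖T ∘L indBall μ x r‖) ξ (𝓝 0)) :
    T ∈ idealJ μ (coarseEnvelope ξ) := by
  have := hX.proper
  have := hX.noncompact
  have : Nonempty X := not_isEmpty_iff.1 fun _ =>
    noncompact_univ X (by rw [univ_eq_empty_iff.2 ‹_›]; exact isCompact_empty)
  have hball : ∀ (x : X) (r : ℝ),
      μ (Metric.closedBall x r) ≤ ⨆ x : X, μ (Metric.closedBall x r) := fun x r =>
    le_iSup (fun x => μ (Metric.closedBall x r)) x
  -- Together with second countability this makes `μ` s-finite, as Tonelli requires.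
  have : IsLocallyFiniteMeasure μ := ⟨fun x => ⟨Metric.closedBall x 1,
    Metric.closedBall_mem_nhds x one_pos,
    (hball x 1).trans_lt (hX.ball_bdd 1 one_pos)⟩⟩
  refine (mem_idealJ_iff hT).2 fun ε hε => ?_
  -- The total stays below `5 * δ`: `S` is bounded by `2 * δ` on balls centred in `F`, hence by `4 *
  -- δ` on `F`, and `T - S` adds less than `δ`.
  obtain ⟨δ, hδ, rfl⟩ : ∃ δ, 0 < δ ∧ ε = 6 * δ := ⟨ε / 6, by positivity, by ring⟩
  obtain ⟨k, S, R, M, hR, hkM, hkc, hk, hS, hTS⟩ := exists_controlled_approx hT hδ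
  -- Radius `R + 1` because `R` may be 0, while the volume bound is assumed only for positive radii.
  set V : ℝ≥0∞ := ⨆ x : X, μ (Metric.closedBall x (R + 1))
  have hVfin : V ≠ ∞ := (hX.ball_bdd (R + 1) (by positivity)).ne
  have hV : ∀ x, μ (Metric.closedBall x R) ≤ V := fun x =>
    (measure_mono (Metric.closedBall_subset_closedBall (by linarith))).trans
      (hball x (R + 1))
  have hM : 0 ≤ M := (norm_nonneg _).trans (hkM (Classical.arbitrary _))
  -- `η` is chosen so that `M * V * η ≤ 2 * δ`; the `+ 1` in the denominator keeps it positive.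
  -- Scale `R + 1` turns the condition `dist x y ≤ R` into a strict inequality.
  obtain ⟨ψ, c, s, hs, hψm, hψ1, hψ, hψs⟩ := hX.propertyA.exists_partition
    (η := 2 * δ / (M * V.toReal + 1)) (r := R + 1) (by positivity) (by positivity)
  have hη_le : ENNReal.ofReal M * V * ENNReal.ofReal (2 * δ / (M * V.toReal + 1)) ≤
      ENNReal.ofReal (2 * δ) := by
    nth_rewrite 1 [← ENNReal.ofReal_toReal hVfin]
    rw [← ENNReal.ofReal_mul hM, ← ENNReal.ofReal_mul (by positivity)]
    refine ENNReal.ofReal_le_ofReal ?_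
    rw [mul_div_assoc', div_le_iff₀ (by positivity)]
    nlinarith
  have hFm : MeasurableSet (interior {x | ‖T ∘L indBall μ x (R + 2 * s)‖ ≤ δ}) :=
    isOpen_interior.measurableSet
  refine ⟨_, interior_setOf_norm_comp_indBall_le_mem h hδ (t := R + 2 * s) (by positivity),
    hFm, ?_⟩
  have h1 : ‖ind μ hFm ∘L S‖ ≤ 2 * (2 * δ) := by
    refine norm_ind_comp_le_of_forall_indBall hS hkc hkM hk hV hVfin ENNReal.ofReal_ne_top hψm hψ1
      (fun x y hxy => hψ x y (by linarith)) hψs (by positivity) hη_le hFm fun z hz => ?_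
    have h2 : ‖T ∘L indBall μ z (R + 2 * s)‖ ≤ δ :=
      interior_subset (s := {x | ‖T ∘L indBall μ x (R + 2 * s)‖ ≤ δ}) hz
    have h3 := norm_comp_ind_le (μ := μ) _
      (Metric.isClosed_closedBall (x := z) (ε := R + 2 * s)).measurableSet (T - S)
    have h4 : S ∘L indBall μ z (R + 2 * s) =
        T ∘L indBall μ z (R + 2 * s) - (T - S) ∘L indBall μ z (R + 2 * s) := by
      rw [ContinuousLinearMap.sub_comp]; abel
    rw [h4]
    refine (norm_sub_le _ _).trans ?_
    unfold indBall at *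
    linarith
  have h5 : ind μ hFm ∘L T = ind μ hFm ∘L (T - S) + ind μ hFm ∘L S := by
    rw [ContinuousLinearMap.comp_sub]; abel
  have h6 := norm_ind_comp_le _ hFm (T - S)
  rw [h5]
  linarith [norm_add_le (ind μ hFm ∘L (T - S)) (ind μ hFm ∘L S)]

end Main

end CoarseElliptic

theorem theorem4p10 {X : Type*} [MetricSpace X] [MeasurableSpace X] [BorelSpace X]
    (μ : Measure X) (hX : CoarseElliptic.IsClassA μ) :
    (∀ ξ : Filter X, ξ.NeBot → ξ ≤ cocompact X →
      ∀ T ∈ CoarseElliptic.ellipticAlgebra μ,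
        (T ∈ CoarseElliptic.idealJ μ (CoarseElliptic.coarseEnvelope ξ) ↔
          ∀ r : ℝ, 0 < r →
            Tendsto (fun x => ‖T ∘L CoarseElliptic.indBall μ x r‖) ξ (𝓝 0)) ∧
        ((∀ r : ℝ, 0 < r →
            Tendsto (fun x => ‖T ∘L CoarseElliptic.indBall μ x r‖) ξ (𝓝 0)) ↔
          ∀ r : ℝ, 0 < r →
            Tendsto (fun x => ‖CoarseElliptic.indBall μ x r ∘L T‖) ξ (𝓝 0))) ∧
    (∀ ϰ ∈ CoarseElliptic.delta X,
      CoarseElliptic.idealE μ ϰ = CoarseElliptic.idealG μ (ϰ : Filter X)) := by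
  have key : ∀ (ξ : Filter X), ∀ T ∈ CoarseElliptic.ellipticAlgebra μ,
      (T ∈ CoarseElliptic.idealJ μ (CoarseElliptic.coarseEnvelope ξ) ↔
        ∀ r : ℝ, 0 < r →
          Tendsto (fun x => ‖T ∘L CoarseElliptic.indBall μ x r‖) ξ (𝓝 0)) := fun ξ T hT =>
    ⟨fun h => (CoarseElliptic.tendsto_comp_indBall_iff hT ξ).2
      (CoarseElliptic.tendsto_indBall_comp_of_mem_idealJ h),
      CoarseElliptic.mem_idealJ_of_tendsto_comp_indBall hX hT⟩
  refine ⟨fun ξ _ _ T hT => ⟨key ξ T hT, CoarseElliptic.tendsto_comp_indBall_iff hT ξ⟩,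
    fun ϰ _ => Set.ext fun T => ⟨fun h => ⟨h.1, ?_⟩, fun h => ?_⟩⟩
  · exact CoarseElliptic.tendsto_indBall_comp_of_mem_idealJ h
  · exact (key _ T h.1).2 ((CoarseElliptic.tendsto_comp_indBall_iff h.1 _).2 h.2)
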